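/- \textbf{Impossibility of finding independent components.} \emph{Model.} Let $d\ge n$. A latent model consists of: a directed acyclic graph on $Z_1,\dots,Z_n$ with an edge $Z_j\to Z_i$ if and only if $Z_j\in\mathrm{PA}(Z_i)$; mechanisms $Z_i=f_i(\mathrm{PA}(Z_i),\epsilon_i;\theta_i)$, $i=1,\dots,n$, with mutually independent exogenous noises $\epsilon_1,\dots,\epsilon_n$ and real-valued $Z_i$; a family of domains $\theta^{(u)}=(\theta^{(u)}_1,\dots,\theta^{(u)}_n)$, $u\in U$; and a mixing map $g:\mathbb R^n\to\mathbb R^d$ that is a $C^2$-diffeomorphism onto its image (a $C^2$ immersion that is a homeomorphism onto its image). Put $X=g(Z)$, and write $P_{Z;\theta}$ and $P_{X;\theta}$ for the laws of $Z$ and $X$ in the domain $\theta$. Let $(g,f,P_Z,(\theta^{(u)})_{u\in U})$ be the true model and $\mathcal G_Z$ its graph. Let $\mathcal M_Z$ be its Markov network, that is, the undirected graph on $\{1,\dots,n\}$ in which $i\ne j$ are adjacent if and only if, for at least one $u\in U$, $Z_i$ and $Z_j$ are not conditionally independent given $Z_{[n]\setminus\{i,j\}}$ under $P_{Z;\theta^{(u)}}$.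 Let $|\mathcal M_Z|$ be its number of edges. \emph{Assumptions on the true model.} \begin{itemize} \item A1: for every $u\in U$, $P_{Z;\theta^{(u)}}$ has a density $p(\cdot\,;\theta^{(u)})$ that is positive and twice continuously differentiable on $\mathbb R^n$. \item A2: for every $z\in\mathbb R^n$ there are $2n+|\mathcal M_Z|+1$ domains $u_0,u_1,\dots,u_{2n+|\mathcal M_Z|}\in U$ such that the vectors $w(z,u_k)-w(z,u_0)$, $1\le k\le 2n+|\mathcal M_Z|$, are linearly independent, where $$w(z,u)=\Big(\tfrac{\partial\log p(z;\theta^{(u)})}{\partial z_i}\Big)_{i\in[n]}\oplus\Big(\tfrac{\partial^2\log p(z;\theta^{(u)})}{\partial z_i^2}\Big)_{i\in[n]}\oplus\Big(\tfrac{\partial^2\log p(z;\theta^{(u)})}{\partial z_i\,\partial z_j}\Big)_{\{i,j\}\in\mathcal E(\mathcal M_Z),\ i<j}.$$ \item Single adjacency-faithfulness: if $Z_i$ and $Z_j$ are adjacent in $\mathcal G_Z$, then for some $u\in U$ they are not conditionally independent given $Z_{[n]\setminus\{i,j\}}$ under $P_{Z;\theta^{(u)}}$. \item Single unshielded-collider-faithfulness: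 if $Z_i\to Z_j\leftarrow Z_k$ in $\mathcal G_Z$ with $i\neq k$ and $Z_i,Z_k$ not adjacent in $\mathcal G_Z$, then for some $u\in U$, $Z_i$ and $Z_k$ are not conditionally independent given $Z_{[n]\setminus\{i,k\}}$ under $P_{Z;\theta^{(u)}}$. \item $\mathcal G_Z$ has at least one edge. \end{itemize} \emph{Conclusion.} Let $(\hat g,\hat f,P_{\hat Z},(\hat\theta^{(u)})_{u\in U})$ be any model of the same form, with the same $n$, $d$ and $U$ (its graph, mechanisms, noises and parameters being arbitrary), such that $\hat Z_1,\dots,\hat Z_n$ are mutually independent under $P_{\hat Z;\hat\theta^{(u)}}$ for every $u\in U$. Then it cannot match the observed distributions in all domains: $P_{X;\theta^{(u)}}\ne P_{\hat X;\hat\theta^{(u)}}$ for at least one $u\in U$. -/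

import Mathlib

open MeasureTheory ProbabilityTheory

namespace LatentCausal

/-! ### Structural equation models -/

/-- A latent structural equation model `Z i = f i (PA (Z i), ε i; θ i)`, `i = 1, …, n`, over an
acyclic causal graph with an edge `Z j → Z i` exactly when `j ∈ PA i`. The parameter `θ i` ranges
over an arbitrary type `T i`; the exogenous noise `ε i` takes values in an arbitrary measurable
space `E i` and has the law `noise i`. -/
structure LatentSEM (n : ℕ) (T : Fin n → Type*) (E : Fin n → Type*)
    [∀ i, MeasurableSpace (E i)] where
  /-- the parents of each variable -/
  PA : Fin n → Finset (Fin n)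
  /-- the causal graph has no directed cycle -/
  acyclic : ∀ i, ¬ Relation.TransGen (fun j k => j ∈ PA k) i i
  /-- the causal mechanisms -/
  f : ∀ i, ({j // j ∈ PA i} → ℝ) → E i → T i → ℝ
  measurable_f : ∀ i t, Measurable (fun q : ({j // j ∈ PA i} → ℝ) × E i => f i q.1 q.2 t)
  /-- the laws of the exogenous noise variables -/
  noise : ∀ i, Measure (E i)
  isProbabilityMeasure_noise : ∀ i, IsProbabilityMeasure (noise i)

namespace LatentSEM

variable {n : ℕ} {T : Fin n → Type*} {E : Fin n → Type*} [∀ i, MeasurableSpace (E i)]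

/-- `S.Edge j i` is the directed edge `Z j → Z i` of the causal graph. -/
def Edge (S : LatentSEM n T E) (j i : Fin n) : Prop := j ∈ S.PA i

/-- Adjacency in the causal graph: an edge in one of the two directions. -/
def Adjacent (S : LatentSEM n T E) (i j : Fin n) : Prop := S.Edge i j ∨ S.Edge j i

theorem wellFounded_edge (S : LatentSEM n T E) : WellFounded S.Edge := by
  have : Std.Irrefl (Relation.TransGen S.Edge) := ⟨S.acyclic⟩
  have h : WellFounded (Relation.TransGen S.Edge) :=
    Finite.wellFounded_of_trans_of_irrefl (Relation.TransGen S.Edge)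
  exact Subrelation.wf (fun hab => Relation.TransGen.single hab) h

/-- The value of the latent vector `Z` determined by the noise `e` and the parameters `t`: the
solution of the structural equations, see `latent_eq` and `eq_latent`. -/
noncomputable def latent (S : LatentSEM n T E) (t : ∀ i, T i) (e : ∀ i, E i) : Fin n → ℝ :=
  S.wellFounded_edge.fix (fun i ih => S.f i (fun j => ih j.1 j.2) (e i) (t i))

theorem latent_eq (S : LatentSEM n T E) (t : ∀ i, T i) (e : ∀ i, E i) (i : Fin n) :
    S.latent t e i = S.f i (fun j => S.latent t e j.1) (e i) (t i) := by
  unfold latent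
  rw [WellFounded.fix_eq]

theorem eq_latent (S : LatentSEM n T E) (t : ∀ i, T i) (e : ∀ i, E i) (z : Fin n → ℝ)
    (hz : ∀ i, z i = S.f i (fun j => z j.1) (e i) (t i)) : z = S.latent t e := by
  funext i
  induction i using S.wellFounded_edge.induction with
  | _ i ih =>
    rw [hz i, S.latent_eq t e i]
    congr 1
    funext j
    exact ih j.1 j.2

theorem measurable_latent (S : LatentSEM n T E) (t : ∀ i, T i) : Measurable (S.latent t) := by
  refine measurable_pi_iff.mpr fun i => ?_
  induction i using S.wellFounded_edge.induction with
  | _ i ih =>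
    have h : (fun e => S.latent t e i) =
        (fun q : ({j // j ∈ S.PA i} → ℝ) × E i => S.f i q.1 q.2 (t i)) ∘
          (fun e : ∀ i, E i => ((fun j : {j // j ∈ S.PA i} => S.latent t e j.1), e i)) := by
      funext e
      exact S.latent_eq t e i
    rw [h]
    refine (S.measurable_f i (t i)).comp (Measurable.prodMk ?_ (measurable_pi_apply i))
    exact measurable_pi_iff.mpr fun j => ih j.1 j.2

/-- The distribution `P_{Z;θ}` of the latent vector for mutually independent noise variables. -/
noncomputable def law (S : LatentSEM n T E) (t : ∀ i, T i) : Measure (Fin n → ℝ) :=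
  haveI := S.isProbabilityMeasure_noise
  (Measure.pi S.noise).map (S.latent t)

instance (S : LatentSEM n T E) (t : ∀ i, T i) : IsProbabilityMeasure (S.law t) := by
  have := S.isProbabilityMeasure_noise
  exact Measure.isProbabilityMeasure_map (S.measurable_latent t).aemeasurable

/-- The distribution `P_{X;θ}` of the observed vector `X = g(Z)`. -/
noncomputable def observedLaw {d : ℕ} (S : LatentSEM n T E) (g : (Fin n → ℝ) → (Fin d → ℝ))
    (t : ∀ i, T i) : Measure (Fin d → ℝ) :=
  (S.law t).map g

end LatentSEM

/-- `g` is a `C²`-diffeomorphism onto its image: a `C²` immersion that is a homeomorphism onto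
its image. -/
structure IsC2DiffeoOntoImage {n d : ℕ} (g : (Fin n → ℝ) → (Fin d → ℝ)) : Prop where
  contDiff : ContDiff ℝ 2 g
  isEmbedding : Topology.IsEmbedding g
  injective_fderiv : ∀ z, Function.Injective (fderiv ℝ g z)

/-! ### Conditional independence and Markov networks -/

/-- The σ-algebra generated by the coordinates with index outside `A`. -/
@[reducible] def sigmaOutside {n : ℕ} (A : Finset (Fin n)) : MeasurableSpace (Fin n → ℝ) :=
  MeasurableSpace.comap (fun (z : Fin n → ℝ) (k : {k // k ∉ A}) => z k.1) inferInstance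

theorem sigmaOutside_le {n : ℕ} (A : Finset (Fin n)) :
    sigmaOutside A ≤ (inferInstance : MeasurableSpace (Fin n → ℝ)) :=
  Measurable.comap_le (measurable_pi_iff.mpr fun k => measurable_pi_apply k.1)

/-- `Z i` and `Z j` are conditionally independent given all the other coordinates, for `Z ∼ μ`. -/
def CondIndepGivenRest {n : ℕ} (μ : Measure (Fin n → ℝ)) [IsFiniteMeasure μ] (i j : Fin n) :
    Prop :=
  CondIndepFun (sigmaOutside {i, j}) (sigmaOutside_le {i, j})
    (fun z : Fin n → ℝ => z i) (fun z : Fin n → ℝ => z j) μ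

theorem CondIndepGivenRest.symm {n : ℕ} {μ : Measure (Fin n → ℝ)} [IsFiniteMeasure μ]
    {i j : Fin n} (h : CondIndepGivenRest μ i j) : CondIndepGivenRest μ j i := by
  unfold CondIndepGivenRest at h ⊢
  have h2 := CondIndepFun.symm h
  simpa only [Finset.pair_comm i j] using h2

/-- The Markov network of the latent vector in a family of domains `u`, with laws `μ u`: there is
no edge between `i` and `j` when `Z i` and `Z j` are conditionally independent given the other
variables in every domain. If all the domains have the same Markov network, it is this one. -/
def markovNetwork {n : ℕ} {U : Type*} (μ : U → Measure (Fin n → ℝ)) [∀ u, IsFiniteMeasure (μ u)] :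
    SimpleGraph (Fin n) where
  Adj i j := i ≠ j ∧ ∃ u, ¬ CondIndepGivenRest (μ u) i j
  symm := ⟨fun _ _ h => ⟨h.1.symm, h.2.imp fun _ hu hc => hu hc.symm⟩⟩
  loopless := ⟨fun _ h => h.1 rfl⟩

/-! ### The assumptions -/

/-- A1: `p` is a density of `μ` that is positive and twice continuously differentiable on `ℝⁿ`. -/
structure HasSmoothPositiveDensity {n : ℕ} (μ : Measure (Fin n → ℝ)) (p : (Fin n → ℝ) → ℝ) :
    Prop where
  eq_withDensity : μ = volume.withDensity (fun z => ENNReal.ofReal (p z))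
  contDiff : ContDiff ℝ 2 p
  pos : ∀ z, 0 < p z

/-- The partial derivative `∂F/∂z_i`. -/
noncomputable def partialDeriv {n : ℕ} (i : Fin n) (F : (Fin n → ℝ) → ℝ) (z : Fin n → ℝ) : ℝ :=
  fderiv ℝ F z (Pi.single i 1)

/-- The vector `w(z, u)` for `p = p(· ; θ⁽ᵘ⁾)` and the Markov network `M`: the first partial
derivatives of `log p`, then the pure second ones, then the mixed second ones along the edges
`{i, j}` of `M` with `i < j`. -/
noncomputable def changeVector {n : ℕ} (M : SimpleGraph (Fin n)) (p : (Fin n → ℝ) → ℝ)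
    (z : Fin n → ℝ) : Fin n ⊕ Fin n ⊕ {e : Fin n × Fin n // e.1 < e.2 ∧ M.Adj e.1 e.2} → ℝ
  | Sum.inl i => partialDeriv i (fun x => Real.log (p x)) z
  | Sum.inr (Sum.inl i) => partialDeriv i (partialDeriv i (fun x => Real.log (p x))) z
  | Sum.inr (Sum.inr e) =>
      partialDeriv e.1.1 (partialDeriv e.1.2 (fun x => Real.log (p x))) z

/-- A2 (sufficient changes): for each `z` there are `2n + |M| + 1` domains, `u₀` and `u k`, such
that the vectors `w(z, u k) - w(z, u₀)` are linearly independent; `|M|` is the number of edges. -/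
def SufficientChanges {n : ℕ} {U : Type*} (M : SimpleGraph (Fin n))
    (p : U → (Fin n → ℝ) → ℝ) : Prop :=
  ∀ z : Fin n → ℝ, ∃ (u₀ : U) (u : Fin (2 * n + M.edgeSet.ncard) → U),
    LinearIndependent ℝ (fun k => changeVector M (p (u k)) z - changeVector M (p u₀) z)

section Faithfulness

variable {n : ℕ} {T : Fin n → Type*} {E : Fin n → Type*} [∀ i, MeasurableSpace (E i)] {U : Type*}

/-- Single adjacency-faithfulness: variables that are adjacent in the causal graph are not
conditionally independent given all the others (throughout the domains). -/
def SingleAdjacencyFaithful (S : LatentSEM n T E) (θ : U → ∀ i, T i) : Prop :=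
  ∀ i j, S.Adjacent i j → ∃ u, ¬ CondIndepGivenRest (S.law (θ u)) i j

/-- Single unshielded-collider-faithfulness: the end points of an unshielded collider
`Z i → Z j ← Z k` are not conditionally independent given all the others (throughout the
domains). -/
def SingleUnshieldedColliderFaithful (S : LatentSEM n T E) (θ : U → ∀ i, T i) : Prop :=
  ∀ i j k, i ≠ k → S.Edge i j → S.Edge k j → ¬ S.Adjacent i k →
    ∃ u, ¬ CondIndepGivenRest (S.law (θ u)) i k

end Faithfulness

end LatentCausal

/-! Suppose all observed laws agree. Almost every `g z` then lies in the image of `g'`, and near a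
suitable point `z` the map `g'⁻¹ ∘ g` is a local `C²` diffeomorphism `h`
(`exists_local_transition`), the same for all domains. For two domains put `L = log p_u - log
p_{u₀}`. The Jacobian of `h` does not depend on the domain, so it cancels in the ratio of densities.
Since the estimated latents are independent, `F = L ∘ h⁻¹` is locally a sum of functions of single
coordinates, and its mixed second partials vanish (`density_ratio_rectangle`,
`partialDeriv_partialDeriv_eq_zero`).

By the chain rule every difference of change vectors at `z` is then the image, under one linear map
`jetMap` depending only on `h`, of the `2n` numbers `∂ₖF`, `∂ₖ²F` (`changeVector_sub_eq_jetMap`). At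
most `2n` such differences can be linearly independent, whereas A2 provides `2n + |M|`, and `|M| >
0` by adjacency-faithfulness.

The estimated laws are not assumed to have densities. A change-of-variables formula is therefore
replaced by limits of ratios of masses of small cubes. -/

namespace LatentCausal

open Filter Topology Set

/-! ### The local transition map between the two embeddings. -/

/-- Two `C²`-embeddings whose images overlap in a set with dense preimage differ, near a common
point, by a local homeomorphism that is `C²` in both directions. -/
theorem exists_local_transition {n d : ℕ} {g g' : (Fin n → ℝ) → (Fin d → ℝ)}
    (hg : IsC2DiffeoOntoImage g) (hg' : IsC2DiffeoOntoImage g')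
    (hA : Dense (g ⁻¹' range g')) {z₀ : Fin n → ℝ} (hz₀ : g z₀ ∈ range g') :
    ∃ h : OpenPartialHomeomorph (Fin n → ℝ) (Fin n → ℝ), z₀ ∈ h.source ∧
      (∀ᶠ z in 𝓝 z₀, g' (h z) = g z) ∧ ContDiffAt ℝ 2 h z₀ ∧ ContDiffAt ℝ 2 h.symm (h z₀) := by
  obtain ⟨y₀, hy₀⟩ := hz₀
  obtain ⟨l, hl⟩ := LinearMap.exists_leftInverse_of_injective
    (fderiv ℝ g' y₀ : (Fin n → ℝ) →ₗ[ℝ] (Fin d → ℝ))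
    (LinearMap.ker_eq_bot.mpr (hg'.injective_fderiv y₀))
  have hlc : ContDiff ℝ 2 (fun x => l x) := l.toContinuousLinearMap.contDiff
  have hφc : ContDiffAt ℝ 2 (fun y => l (g' y)) y₀ := (hlc.comp hg'.contDiff).contDiffAt
  have hφd : HasFDerivAt (fun y => l (g' y))
      ((ContinuousLinearEquiv.refl ℝ (Fin n → ℝ) : (Fin n → ℝ) →L[ℝ] (Fin n → ℝ))) y₀ := by
    have h1 := (l.toContinuousLinearMap.hasFDerivAt (x := g' y₀)).comp y₀
      (hg'.contDiff.differentiable two_ne_zero y₀).hasFDerivAt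
    exact h1.congr_fderiv (ContinuousLinearMap.ext fun v => LinearMap.congr_fun hl v)
  set e := hφc.toOpenPartialHomeomorph (fun y => l (g' y)) hφd two_ne_zero with he
  have hye : y₀ ∈ e.source := hφc.mem_toOpenPartialHomeomorph_source hφd two_ne_zero
  have hec : ∀ y, e y = l (g' y) := fun y => rfl
  -- This candidate for `g'⁻¹ ∘ g` is `C²` near `z₀` without presupposing that `g z` lies in the
  -- image of `g'`: the linear map `l` makes `l ∘ g'` locally invertible at `y₀`.
  set h₀ : (Fin n → ℝ) → (Fin n → ℝ) := fun z => e.symm (l (g z)) with hh₀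
  have hh₀z : h₀ z₀ = y₀ := by
    simp only [hh₀, ← hy₀, ← hec]
    exact e.left_inv hye
  have hh₀c : ContDiffAt ℝ 2 h₀ z₀ := by
    have h1 : ContDiffAt ℝ 2 e.symm (l (g z₀)) := by
      rw [← hy₀]
      exact hφc.to_localInverse hφd two_ne_zero
    exact h1.comp z₀ (hlc.comp hg.contDiff).contDiffAt
  -- Density upgrades to all nearby points: the image of a compact ball under `g'` is closed and
  -- contains `g z` for a dense set of `z` near `z₀`, hence for every such `z`.
  have hgh : ∀ᶠ z in 𝓝 z₀, g' (h₀ z) = g z := by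
    obtain ⟨r, hr, hK⟩ := Metric.nhds_basis_closedBall.mem_iff.mp (e.open_source.mem_nhds hye)
    obtain ⟨V, hVo, hV⟩ := hg'.isEmbedding.isInducing.isOpen_iff.mp
      (Metric.isOpen_ball (x := y₀) (ε := r))
    have hKc : IsClosed (g' '' Metric.closedBall y₀ r) :=
      ((isCompact_closedBall y₀ r).image hg'.contDiff.continuous).isClosed
    have hVz : z₀ ∈ g ⁻¹' V := by
      have : y₀ ∈ g' ⁻¹' V := hV ▸ Metric.mem_ball_self hr
      simpa [hy₀] using this
    have hVo' : IsOpen (g ⁻¹' V) := hVo.preimage hg.contDiff.continuous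
    filter_upwards [hVo'.mem_nhds hVz] with z hz
    have hzK : g z ∈ g' '' Metric.closedBall y₀ r := by
      have h1 : MapsTo g (g ⁻¹' V ∩ g ⁻¹' range g') (g' '' Metric.closedBall y₀ r) := by
        rintro x ⟨hxV, y, hy⟩
        refine ⟨y, Metric.ball_subset_closedBall ?_, hy⟩
        rw [← hV, mem_preimage, hy]
        exact hxV
      have h2 := h1.closure hg.contDiff.continuous (hA.open_subset_closure_inter hVo' hz)
      rwa [hKc.closure_eq] at h2
    obtain ⟨y, hyK, hy⟩ := hzK
    have : h₀ z = y := by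
      simp only [hh₀, ← hy, ← hec]
      exact e.left_inv (hK hyK)
    rw [this, hy]
  -- Differentiating `g' ∘ h₀ = g` shows that the derivative of `h₀` is injective, hence invertible
  -- as an endomorphism.
  have hinj : Function.Injective (fderiv ℝ h₀ z₀) := by
    have h1 : HasFDerivAt (fun z => g' (h₀ z)) ((fderiv ℝ g' (h₀ z₀)).comp (fderiv ℝ h₀ z₀)) z₀ :=
      (hg'.contDiff.differentiable two_ne_zero _).hasFDerivAt.comp z₀
        (hh₀c.differentiableAt two_ne_zero).hasFDerivAt
    have h2 := (h1.congr_of_eventuallyEq (hgh.mono fun z hz => hz.symm)).fderiv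
    have h3 := hg.injective_fderiv z₀
    rw [h2] at h3
    exact Function.Injective.of_comp h3
  let E : (Fin n → ℝ) ≃L[ℝ] (Fin n → ℝ) :=
    (LinearEquiv.ofInjectiveEndo (fderiv ℝ h₀ z₀ : (Fin n → ℝ) →ₗ[ℝ] (Fin n → ℝ))
      hinj).toContinuousLinearEquiv
  have hE : HasFDerivAt h₀ (E : (Fin n → ℝ) →L[ℝ] (Fin n → ℝ)) z₀ :=
    (hh₀c.differentiableAt two_ne_zero).hasFDerivAt.congr_fderiv
      (ContinuousLinearMap.ext fun _ => rfl)
  exact ⟨hh₀c.toOpenPartialHomeomorph h₀ hE two_ne_zero,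
    hh₀c.mem_toOpenPartialHomeomorph_source hE two_ne_zero, hgh, hh₀c,
    hh₀c.to_localInverse hE two_ne_zero⟩

/-! ### Densities as limits of averages, and product measures on cubes. -/

/-- The density of a measure at a point is the limit of its averages over sets that shrink to
that point. -/
theorem HasSmoothPositiveDensity.tendsto_average {n : ℕ} {μ : Measure (Fin n → ℝ)}
    {p : (Fin n → ℝ) → ℝ} (hp : HasSmoothPositiveDensity μ p) {ι : Type*} {l : Filter ι}
    {s : ι → Set (Fin n → ℝ)} {z : Fin n → ℝ} (hs : Tendsto s l (𝓝 z).smallSets)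
    (hsm : ∀ i, MeasurableSet (s i)) (hs0 : ∀ᶠ i in l, volume (s i) ≠ 0) :
    Tendsto (fun i => μ.real (s i) / volume.real (s i)) l (𝓝 (p z)) := by
  have hpc : Continuous p := hp.contDiff.continuous
  have h1 := (hpc.continuousAt (x := z)).integral_sub_linear_isLittleO_ae (μ := volume)
    hpc.stronglyMeasurable.stronglyMeasurableAtFilter hs
  have h2 := h1.tendsto_div_nhds_zero.add_const (p z)
  rw [zero_add] at h2
  refine h2.congr' ?_
  have hfin : ∀ᶠ i in l, s i ⊆ Metric.ball z 1 :=
    (tendsto_smallSets_iff.mp hs) _ (Metric.ball_mem_nhds z one_pos)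
  filter_upwards [hs0, hfin] with i hi hf
  have hv : volume.real (s i) ≠ 0 :=
    (ENNReal.toReal_pos hi (measure_ne_top_of_subset hf measure_ball_lt_top.ne)).ne'
  have hint : ∫ x in s i, p x = μ.real (s i) := by
    rw [integral_eq_lintegral_of_nonneg_ae (ae_of_all _ fun x => (hp.pos x).le)
      hpc.aestronglyMeasurable, Measure.real, hp.eq_withDensity, withDensity_apply _ (hsm i)]
  rw [hint, smul_eq_mul]
  field_simp
  ring

theorem HasSmoothPositiveDensity.volume_absolutelyContinuous {n : ℕ} {μ : Measure (Fin n → ℝ)}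
    {p : (Fin n → ℝ) → ℝ} (hp : HasSmoothPositiveDensity μ p) : volume ≪ μ := by
  rw [hp.eq_withDensity]
  refine withDensity_absolutelyContinuous' ?_ ?_
  · exact hp.contDiff.continuous.measurable.ennreal_ofReal.aemeasurable
  · exact ae_of_all _ fun x => (ENNReal.ofReal_pos.mpr (hp.pos x)).ne'

/-- The mass that a product measure gives to a cube is a product of functions of the coordinates
of its centre. -/
theorem measureReal_ball_of_iIndepFun {n : ℕ} {ν : Measure (Fin n → ℝ)}
    (hν : iIndepFun (fun (i : Fin n) (z : Fin n → ℝ) => z i) ν) {ε : ℝ} (hε : 0 < ε)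
    (y : Fin n → ℝ) :
    ν.real (Metric.ball y ε) = ∏ i, ν.real ((fun z : Fin n → ℝ => z i) ⁻¹' Metric.ball (y i) ε) := by
  have h := hν.measure_inter_preimage_eq_mul Finset.univ
    (sets := fun i => Metric.ball (y i) ε) (fun i _ => measurableSet_ball)
  have hb : Metric.ball y ε = ⋂ i ∈ Finset.univ, (fun z : Fin n → ℝ => z i) ⁻¹' Metric.ball (y i) ε := by
    rw [ball_pi y hε]
    ext z
    simp
  simp only [Measure.real]
  rw [hb, h, ENNReal.toReal_prod]

/-- `a`, `b`, `c`, `d` are the vertices of a rectangle with sides parallel to the axes and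
diagonals `a d` and `b c`. -/
def IsRectangle {n : ℕ} (a b c d : Fin n → ℝ) : Prop :=
  ∀ i, (a i = b i ∧ c i = d i) ∨ (a i = c i ∧ b i = d i)

theorem IsRectangle.prod_mul_prod {n : ℕ} {a b c d : Fin n → ℝ} (h : IsRectangle a b c d)
    (m : Fin n → ℝ → ℝ) :
    (∏ i, m i (a i)) * ∏ i, m i (d i) = (∏ i, m i (b i)) * ∏ i, m i (c i) := by
  rw [← Finset.prod_mul_distrib, ← Finset.prod_mul_distrib]
  refine Finset.prod_congr rfl fun i _ => ?_
  rcases h i with ⟨h1, h2⟩ | ⟨h1, h2⟩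
  · rw [h1, h2]
  · rw [h1, h2, mul_comm]

/-! ### Comparing the two families of laws through the common observed law. -/

section Transport

variable {n d : ℕ} {g g' : (Fin n → ℝ) → (Fin d → ℝ)} {μ ν : Measure (Fin n → ℝ)}
  {p : (Fin n → ℝ) → ℝ}

theorem measurableSet_preimage_image_ball (hg : IsC2DiffeoOntoImage g)
    (hg' : IsC2DiffeoOntoImage g') (y : Fin n → ℝ) (ε : ℝ) :
    MeasurableSet (g ⁻¹' (g' '' Metric.ball y ε)) :=
  hg.contDiff.continuous.measurable
    ((hg'.contDiff.continuous.measurableEmbedding hg'.isEmbedding.injective).measurableSet_image.mpr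
      measurableSet_ball)

theorem measure_preimage_image (hg : IsC2DiffeoOntoImage g) (hg' : IsC2DiffeoOntoImage g')
    (h : μ.map g = ν.map g') {s : Set (Fin n → ℝ)} (hs : MeasurableSet s) :
    μ (g ⁻¹' (g' '' s)) = ν s := by
  have he := hg'.contDiff.continuous.measurableEmbedding hg'.isEmbedding.injective
  rw [← Measure.map_apply hg.contDiff.continuous.measurable (he.measurableSet_image.mpr hs), h,
    he.map_apply, preimage_image_eq _ hg'.isEmbedding.injective]

/-- The common observed law is carried by the image of `g'`, so the exceptional set is `μ`-null.
Positivity of the density makes it Lebesgue-null. -/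
theorem ae_mem_range [IsProbabilityMeasure μ] [IsProbabilityMeasure ν]
    (hg : IsC2DiffeoOntoImage g) (hg' : IsC2DiffeoOntoImage g')
    (hp : HasSmoothPositiveDensity μ p) (h : μ.map g = ν.map g') :
    ∀ᵐ z : Fin n → ℝ, g z ∈ range g' := by
  refine hp.volume_absolutelyContinuous.ae_le ?_
  have he := hg'.contDiff.continuous.measurableEmbedding hg'.isEmbedding.injective
  have h1 := measure_preimage_image hg hg' h MeasurableSet.univ
  rw [image_univ, measure_univ] at h1
  exact (prob_compl_eq_zero_iff (hg.contDiff.continuous.measurable he.measurableSet_range)).mpr h1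

/-- As `g` is an embedding, neighbourhoods of `z` are pulled back from neighbourhoods of `g z = g'
y`. -/
theorem tendsto_preimage_image_ball (hg : IsC2DiffeoOntoImage g)
    (hg' : IsC2DiffeoOntoImage g') {y z : Fin n → ℝ} (hyz : g' y = g z) :
    Tendsto (fun ε => g ⁻¹' (g' '' Metric.ball y ε)) (𝓝[>] 0) (𝓝 z).smallSets := by
  rw [tendsto_smallSets_iff]
  intro t ht
  rw [hg.isEmbedding.isInducing.nhds_eq_comap, ← hyz] at ht
  obtain ⟨V, hV, hVt⟩ := ht
  obtain ⟨r, hr, hrV⟩ := Metric.mem_nhds_iff.mp (hg'.contDiff.continuous.continuousAt hV)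
  filter_upwards [Ioo_mem_nhdsGT hr] with ε hε x hx
  obtain ⟨w, hw, hwx⟩ := hx
  refine hVt ?_
  rw [mem_preimage, ← hwx]
  exact hrV (Metric.ball_subset_ball hε.2.le hw)

/-- Up to a null set, this is the preimage under `g` of an open set, and it contains `z`. -/
theorem volume_preimage_image_ball_ne_zero (hg : IsC2DiffeoOntoImage g)
    (hg' : IsC2DiffeoOntoImage g') (hA : ∀ᵐ z : Fin n → ℝ, g z ∈ range g')
    {y z : Fin n → ℝ} (hyz : g' y = g z) {ε : ℝ} (hε : 0 < ε) :
    volume (g ⁻¹' (g' '' Metric.ball y ε)) ≠ 0 := by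
  obtain ⟨V, hVo, hV⟩ := hg'.isEmbedding.isInducing.isOpen_iff.mp
    (Metric.isOpen_ball (x := y) (ε := ε))
  have hz : z ∈ g ⁻¹' V := by
    have : y ∈ g' ⁻¹' V := hV ▸ Metric.mem_ball_self hε
    simpa [← hyz] using this
  have h1 : volume (g ⁻¹' V) ≠ 0 :=
    ((hVo.preimage hg.contDiff.continuous).measure_pos volume ⟨z, hz⟩).ne'
  have h2 : (g ⁻¹' (g' '' Metric.ball y ε) : Set (Fin n → ℝ)) =ᵐ[volume] g ⁻¹' V := by
    filter_upwards [hA] with x hx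
    obtain ⟨w, hw⟩ := hx
    refine propext ⟨?_, fun hxV => ⟨w, ?_, hw⟩⟩
    · rintro ⟨v, hv, hvx⟩
      rw [← hV] at hv
      have : g x ∈ V := hvx ▸ hv
      exact this
    · rw [← hV, mem_preimage, hw]
      exact hxV
  rwa [measure_congr h2]

/-- The ratio of two densities of laws that an embedding transports to product laws is
multiplicative on rectangles. -/
theorem density_ratio_rectangle (hg : IsC2DiffeoOntoImage g) (hg' : IsC2DiffeoOntoImage g')
    {μ₀ ν₀ : Measure (Fin n → ℝ)} {p₀ : (Fin n → ℝ) → ℝ}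
    (hp : HasSmoothPositiveDensity μ p) (hp₀ : HasSmoothPositiveDensity μ₀ p₀)
    (hA : ∀ᵐ z : Fin n → ℝ, g z ∈ range g')
    (h : μ.map g = ν.map g') (h₀ : μ₀.map g = ν₀.map g')
    (hν : iIndepFun (fun (i : Fin n) (z : Fin n → ℝ) => z i) ν)
    (hν₀ : iIndepFun (fun (i : Fin n) (z : Fin n → ℝ) => z i) ν₀)
    {y₁ y₂ y₃ y₄ : Fin n → ℝ} (hy : IsRectangle y₁ y₂ y₃ y₄) {z₁ z₂ z₃ z₄ : Fin n → ℝ}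
    (h1 : g' y₁ = g z₁) (h2 : g' y₂ = g z₂) (h3 : g' y₃ = g z₃) (h4 : g' y₄ = g z₄) :
    p z₁ / p₀ z₁ * (p z₄ / p₀ z₄) = p z₂ / p₀ z₂ * (p z₃ / p₀ z₃) := by
  -- Both averages are taken over the same shrinking set, so its volume cancels and only masses of
  -- cubes under `ν` and `ν₀` remain.
  have key : ∀ {y z : Fin n → ℝ}, g' y = g z →
      Tendsto (fun ε => ν.real (Metric.ball y ε) / ν₀.real (Metric.ball y ε)) (𝓝[>] 0)
        (𝓝 (p z / p₀ z)) := by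
    intro y z hyz
    have hs := tendsto_preimage_image_ball hg hg' hyz
    have hsm := fun ε => measurableSet_preimage_image_ball hg hg' y ε
    have hs0 : ∀ᶠ ε in 𝓝[>] (0 : ℝ), volume (g ⁻¹' (g' '' Metric.ball y ε)) ≠ 0 :=
      eventually_mem_nhdsWithin.mono fun ε hε =>
        volume_preimage_image_ball_ne_zero hg hg' hA hyz hε
    refine ((hp.tendsto_average hs hsm hs0).div (hp₀.tendsto_average hs hsm hs0)
      (hp₀.pos z).ne').congr' ?_
    have hfin := (tendsto_smallSets_iff.mp hs) _ (Metric.ball_mem_nhds z one_pos)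
    filter_upwards [hs0, hfin] with ε hε hf
    have hv : volume.real (g ⁻¹' (g' '' Metric.ball y ε)) ≠ 0 :=
      (ENNReal.toReal_pos hε (measure_ne_top_of_subset hf measure_ball_lt_top.ne)).ne'
    simp only [Measure.real] at hv ⊢
    rw [Pi.div_apply, measure_preimage_image hg hg' h measurableSet_ball,
      measure_preimage_image hg hg' h₀ measurableSet_ball, div_div_div_cancel_right₀ hv]
  -- The rectangle identity is exact for cubes of each radius `ε`, and passes to the limit.
  refine tendsto_nhds_unique ((key h1).mul (key h4)) (((key h2).mul (key h3)).congr' ?_)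
  filter_upwards [eventually_mem_nhdsWithin] with ε hε
  rw [div_mul_div_comm, div_mul_div_comm]
  simp only [measureReal_ball_of_iIndepFun hν hε, measureReal_ball_of_iIndepFun hν₀ hε]
  rw [hy.prod_mul_prod fun i t => ν.real ((fun z : Fin n → ℝ => z i) ⁻¹' Metric.ball t ε),
    hy.prod_mul_prod fun i t => ν₀.real ((fun z : Fin n → ℝ => z i) ⁻¹' Metric.ball t ε)]

end Transport

/-! ### Calculus of partial derivatives. -/

section PartialDeriv

variable {n : ℕ}

theorem partialDeriv_congr {F G : (Fin n → ℝ) → ℝ} {z : Fin n → ℝ} (h : F =ᶠ[𝓝 z] G)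
    (i : Fin n) : partialDeriv i F z = partialDeriv i G z := by
  simp only [partialDeriv, h.fderiv_eq]

theorem partialDeriv_congr_eventually {F G : (Fin n → ℝ) → ℝ} {z : Fin n → ℝ} (h : F =ᶠ[𝓝 z] G)
    (i : Fin n) : partialDeriv i F =ᶠ[𝓝 z] partialDeriv i G :=
  h.eventuallyEq_nhds.mono fun _ hx => partialDeriv_congr hx i

theorem _root_.ContDiffAt.partialDeriv {F : (Fin n → ℝ) → ℝ} {z : Fin n → ℝ}
    (hF : ContDiffAt ℝ 2 F z) (i : Fin n) : ContDiffAt ℝ 1 (partialDeriv i F) z :=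
  (hF.fderiv_right (m := 1) (by norm_num)).clm_apply contDiffAt_const

theorem partialDeriv_sub {F G : (Fin n → ℝ) → ℝ} {z : Fin n → ℝ} (hF : DifferentiableAt ℝ F z)
    (hG : DifferentiableAt ℝ G z) (i : Fin n) :
    partialDeriv i (fun x => F x - G x) z = partialDeriv i F z - partialDeriv i G z := by
  simp only [partialDeriv]
  rw [fderiv_fun_sub hF hG]
  rfl

theorem partialDeriv_partialDeriv_sub {F G : (Fin n → ℝ) → ℝ} {z : Fin n → ℝ}
    (hF : ContDiff ℝ 2 F) (hG : ContDiff ℝ 2 G) (i j : Fin n) :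
    partialDeriv i (partialDeriv j fun x => F x - G x) z =
      partialDeriv i (partialDeriv j F) z - partialDeriv i (partialDeriv j G) z := by
  have h : (partialDeriv j fun x => F x - G x) =
      fun x => partialDeriv j F x - partialDeriv j G x :=
    funext fun x => partialDeriv_sub (hF.differentiable two_ne_zero x)
      (hG.differentiable two_ne_zero x) j
  rw [h, partialDeriv_sub ((hF.contDiffAt.partialDeriv j).differentiableAt one_ne_zero)
    ((hG.contDiffAt.partialDeriv j).differentiableAt one_ne_zero)]

theorem partialDeriv_comp {F : (Fin n → ℝ) → ℝ} {h : (Fin n → ℝ) → (Fin n → ℝ)} {z : Fin n → ℝ}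
    (hF : DifferentiableAt ℝ F (h z)) (hh : DifferentiableAt ℝ h z) (i : Fin n) :
    partialDeriv i (fun x => F (h x)) z =
      ∑ k, partialDeriv k F (h z) * partialDeriv i (fun x => h x k) z := by
  have h1 : fderiv ℝ (fun x => F (h x)) z = (fderiv ℝ F (h z)).comp (fderiv ℝ h z) :=
    fderiv_comp z hF hh
  have h2 : ∀ k, partialDeriv i (fun x => h x k) z = fderiv ℝ h z (Pi.single i 1) k := by
    intro k
    simp only [partialDeriv]
    rw [fderiv_apply hh k]
    rfl
  simp only [h2]
  rw [partialDeriv, h1, ContinuousLinearMap.comp_apply]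
  conv_lhs => rw [pi_eq_sum_univ' (fderiv ℝ h z (Pi.single i 1))]
  rw [map_sum]
  refine Finset.sum_congr rfl fun k _ => ?_
  rw [map_smul, smul_eq_mul, mul_comm]
  simp only [partialDeriv]

theorem partialDeriv_mul {F G : (Fin n → ℝ) → ℝ} {z : Fin n → ℝ} (hF : DifferentiableAt ℝ F z)
    (hG : DifferentiableAt ℝ G z) (i : Fin n) :
    partialDeriv i (fun x => F x * G x) z =
      F z * partialDeriv i G z + partialDeriv i F z * G z := by
  simp only [partialDeriv]
  rw [fderiv_fun_mul hF hG]
  simp [mul_comm]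

theorem partialDeriv_sum {ι : Type*} {F : ι → (Fin n → ℝ) → ℝ} {z : Fin n → ℝ} (s : Finset ι)
    (hF : ∀ k ∈ s, DifferentiableAt ℝ (F k) z) (i : Fin n) :
    partialDeriv i (fun x => ∑ k ∈ s, F k x) z = ∑ k ∈ s, partialDeriv i (F k) z := by
  simp only [partialDeriv]
  rw [fderiv_fun_sum hF]
  simp

theorem hasDerivAt_partialDeriv {F : (Fin n → ℝ) → ℝ} {z : Fin n → ℝ}
    (hF : DifferentiableAt ℝ F z) (i : Fin n) :
    HasDerivAt (fun t : ℝ => F (z + t • Pi.single i 1)) (partialDeriv i F z) 0 := by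
  simpa [HasLineDerivAt, partialDeriv] using hF.hasFDerivAt.hasLineDerivAt (Pi.single i 1)

/-- A function that is additive on small rectangles has vanishing mixed second partial
derivatives. -/
theorem partialDeriv_partialDeriv_eq_zero {F : (Fin n → ℝ) → ℝ} {y : Fin n → ℝ}
    (hF : ContDiffAt ℝ 2 F y) {i j : Fin n}
    (h : ∀ᶠ q : ℝ × ℝ in 𝓝 (0, 0),
      F (y + q.1 • Pi.single i 1 + q.2 • Pi.single j 1) + F y =
        F (y + q.1 • Pi.single i 1) + F (y + q.2 • Pi.single j 1)) :
    partialDeriv i (partialDeriv j F) y = 0 := by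
  have hd := hasDerivAt_partialDeriv ((hF.partialDeriv j).differentiableAt one_ne_zero) i
  have hdiff : ∀ᶠ x in 𝓝 y, DifferentiableAt ℝ F x :=
    (hF.eventually (by simp)).mono fun x hx => hx.differentiableAt two_ne_zero
  have hc : Tendsto (fun t : ℝ => y + t • (Pi.single i 1 : Fin n → ℝ)) (𝓝 0) (𝓝 y) := by
    have : Continuous fun t : ℝ => y + t • (Pi.single i 1 : Fin n → ℝ) := by fun_prop
    simpa using this.tendsto 0
  -- For fixed small `t`, additivity says that translating by `t` along `i` changes `F` on the
  -- `j`-line only by a constant, so `∂ⱼF` is unchanged.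
  have hconst : (fun t : ℝ => partialDeriv j F (y + t • Pi.single i 1)) =ᶠ[𝓝 0]
      fun _ => partialDeriv j F y := by
    rw [nhds_prod_eq] at h
    filter_upwards [h.curry, hc.eventually hdiff] with t ht htd
    have e1 := hasDerivAt_partialDeriv htd j
    have e2 := (hasDerivAt_partialDeriv hdiff.self_of_nhds j).add_const
      (F (y + t • Pi.single i 1) - F y)
    refine e1.unique (e2.congr_of_eventuallyEq ?_)
    filter_upwards [ht] with s hs
    linarith
  exact hd.unique ((hasDerivAt_const (0 : ℝ) (partialDeriv j F y)).congr_of_eventuallyEq hconst)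

/-- Second partial derivatives of a composition with a function whose mixed second partial
derivatives vanish. -/
theorem partialDeriv_partialDeriv_comp {F : (Fin n → ℝ) → ℝ} {h : (Fin n → ℝ) → (Fin n → ℝ)}
    {z : Fin n → ℝ} (hF : ContDiffAt ℝ 2 F (h z)) (hh : ContDiffAt ℝ 2 h z)
    (hmix : ∀ k l, k ≠ l → partialDeriv k (partialDeriv l F) (h z) = 0) (i j : Fin n) :
    partialDeriv i (partialDeriv j fun x => F (h x)) z =
      ∑ k, (partialDeriv k F (h z) * partialDeriv i (partialDeriv j fun x => h x k) z +
        partialDeriv k (partialDeriv k F) (h z) * partialDeriv i (fun x => h x k) z *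
          partialDeriv j (fun x => h x k) z) := by
  have hhk : ∀ k, ContDiffAt ℝ 2 (fun x => h x k) z := fun k => contDiffAt_pi.mp hh k
  have hhd := hh.differentiableAt two_ne_zero
  have e1 : (partialDeriv j fun x => F (h x)) =ᶠ[𝓝 z]
      fun x => ∑ k, partialDeriv k F (h x) * partialDeriv j (fun x => h x k) x := by
    filter_upwards [hh.continuousAt.eventually (hF.eventually (by simp)),
      hh.eventually (by simp)] with x hx1 hx2
    exact partialDeriv_comp (hx1.differentiableAt two_ne_zero)
      (hx2.differentiableAt two_ne_zero) j
  have hFk : ∀ k, DifferentiableAt ℝ (partialDeriv k F) (h z) := fun k =>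
    (hF.partialDeriv k).differentiableAt one_ne_zero
  have hFh : ∀ k, DifferentiableAt ℝ (fun x => partialDeriv k F (h x)) z := fun k =>
    (hFk k).comp z hhd
  have hhj : ∀ k, DifferentiableAt ℝ (partialDeriv j fun x => h x k) z := fun k =>
    ((hhk k).partialDeriv j).differentiableAt one_ne_zero
  rw [partialDeriv_congr e1, partialDeriv_sum _ fun k _ => (hFh k).fun_mul (hhj k)]
  refine Finset.sum_congr rfl fun k _ => ?_
  -- Vanishing mixed partials reduce the inner chain-rule sum to its diagonal term.
  rw [partialDeriv_mul (hFh k) (hhj k), partialDeriv_comp (hFk k) hhd,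
    Finset.sum_eq_single k (fun l _ hl => by rw [hmix l k hl, zero_mul]) (by simp)]

end PartialDeriv

/-! ### Change vectors as linear images of `2n` derivatives, and the dimension count. -/

/-- The first, pure second and mixed second partial derivatives at `z` of a composition `F ∘ h`,
as a linear function of the first and the pure second partial derivatives of `F` at `h z`, for `F`
with vanishing mixed second partial derivatives. -/
noncomputable def jetMap {n : ℕ} (M : SimpleGraph (Fin n)) (h : (Fin n → ℝ) → (Fin n → ℝ))
    (z : Fin n → ℝ) :
    ((Fin n → ℝ) × (Fin n → ℝ)) →ₗ[ℝ]
      (Fin n ⊕ Fin n ⊕ {e : Fin n × Fin n // e.1 < e.2 ∧ M.Adj e.1 e.2} → ℝ) :=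
  let second : Fin n → Fin n → ((Fin n → ℝ) × (Fin n → ℝ)) →ₗ[ℝ] ℝ := fun i j =>
    ∑ k, (partialDeriv i (partialDeriv j fun x => h x k) z •
        (LinearMap.proj k ∘ₗ LinearMap.fst ℝ (Fin n → ℝ) (Fin n → ℝ)) +
      (partialDeriv i (fun x => h x k) z * partialDeriv j (fun x => h x k) z) •
        (LinearMap.proj k ∘ₗ LinearMap.snd ℝ (Fin n → ℝ) (Fin n → ℝ)))
  LinearMap.pi fun
    | Sum.inl i => ∑ k, partialDeriv i (fun x => h x k) z •
        (LinearMap.proj k ∘ₗ LinearMap.fst ℝ (Fin n → ℝ) (Fin n → ℝ))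
    | Sum.inr (Sum.inl i) => second i i
    | Sum.inr (Sum.inr e) => second e.1.1 e.1.2

theorem changeVector_sub_eq_jetMap {n : ℕ} (M : SimpleGraph (Fin n)) {p p₀ : (Fin n → ℝ) → ℝ}
    (hp : ContDiff ℝ 2 fun x => Real.log (p x)) (hp₀ : ContDiff ℝ 2 fun x => Real.log (p₀ x))
    {F : (Fin n → ℝ) → ℝ} {h : (Fin n → ℝ) → (Fin n → ℝ)} {z : Fin n → ℝ}
    (hF : ContDiffAt ℝ 2 F (h z)) (hh : ContDiffAt ℝ 2 h z)
    (hFh : (fun x => Real.log (p x) - Real.log (p₀ x)) =ᶠ[𝓝 z] fun x => F (h x))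
    (hmix : ∀ k l, k ≠ l → partialDeriv k (partialDeriv l F) (h z) = 0) :
    changeVector M p z - changeVector M p₀ z =
      jetMap M h z (fun k => partialDeriv k F (h z),
        fun k => partialDeriv k (partialDeriv k F) (h z)) := by
  have second : ∀ i j, partialDeriv i (partialDeriv j fun x => Real.log (p x)) z -
      partialDeriv i (partialDeriv j fun x => Real.log (p₀ x)) z =
      ∑ k, (partialDeriv i (partialDeriv j fun x => h x k) z * partialDeriv k F (h z) +
        partialDeriv i (fun x => h x k) z * partialDeriv j (fun x => h x k) z *
          partialDeriv k (partialDeriv k F) (h z)) := by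
    intro i j
    rw [← partialDeriv_partialDeriv_sub hp hp₀,
      partialDeriv_congr (partialDeriv_congr_eventually hFh j) i,
      partialDeriv_partialDeriv_comp hF hh hmix]
    exact Finset.sum_congr rfl fun k _ => by ring
  funext e
  rcases e with i | i | e
  · have := partialDeriv_sub (z := z) (hp.differentiable two_ne_zero z)
      (hp₀.differentiable two_ne_zero z) i
    rw [partialDeriv_congr hFh i, partialDeriv_comp (hF.differentiableAt two_ne_zero)
      (hh.differentiableAt two_ne_zero)] at this
    simp [changeVector, jetMap, ← this, mul_comm]
  · simp [changeVector, jetMap, second]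
  · simp [changeVector, jetMap, second]

theorem HasSmoothPositiveDensity.contDiff_log {n : ℕ} {μ : Measure (Fin n → ℝ)}
    {p : (Fin n → ℝ) → ℝ} (hp : HasSmoothPositiveDensity μ p) :
    ContDiff ℝ 2 fun x => Real.log (p x) :=
  hp.contDiff.log fun x => (hp.pos x).ne'

theorem isRectangle_add_single {n : ℕ} (y : Fin n → ℝ) {i j : Fin n} (hij : i ≠ j) (s t : ℝ) :
    IsRectangle (y + s • Pi.single i 1 + t • Pi.single j 1) (y + s • Pi.single i 1)
      (y + t • Pi.single j 1) y := by
  intro k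
  by_cases hk : k = j
  · subst hk
    right
    simp [Pi.single_eq_of_ne hij.symm]
  · left
    simp [Pi.single_eq_of_ne hk]

/-- The Markov network has an edge when the causal graph has one. -/
theorem markovNetwork_edgeSet_ncard_pos {n : ℕ} {T E : Fin n → Type*} [∀ i, MeasurableSpace (E i)]
    {U : Type*} {S : LatentSEM n T E} {θ : U → ∀ i, T i} (hSAF : SingleAdjacencyFaithful S θ)
    (hG : ∃ i j, S.Edge i j) : 0 < (markovNetwork fun u => S.law (θ u)).edgeSet.ncard := by
  obtain ⟨i, j, hij⟩ := hG
  have hne : i ≠ j := by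
    rintro rfl
    exact S.acyclic i (Relation.TransGen.single hij)
  rw [Set.ncard_pos]
  refine ⟨s(i, j), ?_⟩
  rw [SimpleGraph.mem_edgeSet]
  exact ⟨hne, hSAF i j (Or.inl hij)⟩

/-- The change vectors of laws that an embedding transports to product laws all lie in the range
of one `jetMap`. -/
theorem exists_changeVector_sub_mem_range {n d : ℕ} {U : Type*} (M : SimpleGraph (Fin n))
    {g g' : (Fin n → ℝ) → (Fin d → ℝ)} (hg : IsC2DiffeoOntoImage g) (hg' : IsC2DiffeoOntoImage g')
    {μ ν : U → Measure (Fin n → ℝ)} {p : U → (Fin n → ℝ) → ℝ}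
    (hp : ∀ u, HasSmoothPositiveDensity (μ u) (p u))
    (hA : ∀ᵐ z : Fin n → ℝ, g z ∈ range g')
    (hμν : ∀ u, (μ u).map g = (ν u).map g')
    (hν : ∀ u, iIndepFun (fun (i : Fin n) (z : Fin n → ℝ) => z i) (ν u)) :
    ∃ (z : Fin n → ℝ) (h : (Fin n → ℝ) → (Fin n → ℝ)), ∀ u u₀, ∃ q,
      jetMap M h z q = changeVector M (p u) z - changeVector M (p u₀) z := by
  have hdense : Dense (g ⁻¹' range g') := Measure.dense_of_ae hA
  obtain ⟨z, hz⟩ := hdense.nonempty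
  obtain ⟨h, hzh, hgh, hh, hhs⟩ := exists_local_transition hg hg' hdense hz
  refine ⟨z, h, fun u u₀ => ?_⟩
  set L : (Fin n → ℝ) → ℝ := fun x => Real.log (p u x) - Real.log (p u₀ x) with hL
  have hLc : ContDiff ℝ 2 L := (hp u).contDiff_log.sub (hp u₀).contDiff_log
  have hF : ContDiffAt ℝ 2 (fun y => L (h.symm y)) (h z) := hLc.contDiffAt.comp _ hhs
  have hgs : ∀ᶠ y in 𝓝 (h z), g' y = g (h.symm y) := by
    have hc : Tendsto h.symm (𝓝 (h z)) (𝓝 z) := by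
      have := h.continuousAt_symm (h.map_source hzh)
      rwa [ContinuousAt, h.left_inv hzh] at this
    filter_upwards [hc.eventually hgh, h.open_target.mem_nhds (h.map_source hzh)] with y hy hyt
    rwa [h.right_inv hyt] at hy
  have hlog : ∀ x, L x = Real.log (p u x / p u₀ x) := fun x =>
    (Real.log_div ((hp u).pos x).ne' ((hp u₀).pos x).ne').symm
  have hpos : ∀ x, p u x / p u₀ x ≠ 0 := fun x => (div_pos ((hp u).pos x) ((hp u₀).pos x)).ne'
  -- The logarithm turns multiplicativity of the density ratio on rectangles into additivity.
  have hmix : ∀ k l, k ≠ l → partialDeriv k (partialDeriv l fun y => L (h.symm y)) (h z) = 0 := by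
    intro k l hkl
    refine partialDeriv_partialDeriv_eq_zero hF ?_
    have hev : ∀ {c : ℝ × ℝ → (Fin n → ℝ)}, Continuous c → c (0, 0) = h z →
        ∀ᶠ q in 𝓝 ((0 : ℝ), (0 : ℝ)), g' (c q) = g (h.symm (c q)) := by
      intro c hc hc0
      have := hc.tendsto (0, 0)
      rw [hc0] at this
      exact this.eventually hgs
    filter_upwards [
      hev (c := fun q => h z + q.1 • Pi.single k 1 + q.2 • Pi.single l 1) (by fun_prop) (by simp),
      hev (c := fun q => h z + q.1 • Pi.single k 1) (by fun_prop) (by simp),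
      hev (c := fun q => h z + q.2 • Pi.single l 1) (by fun_prop) (by simp)] with q h1 h2 h3
    have := density_ratio_rectangle hg hg' (hp u) (hp u₀) hA (hμν u) (hμν u₀) (hν u) (hν u₀)
      (isRectangle_add_single (h z) hkl q.1 q.2) h1 h2 h3 hgs.self_of_nhds
    simp only [hlog]
    rw [← Real.log_mul (hpos _) (hpos _), ← Real.log_mul (hpos _) (hpos _), this]
  refine ⟨_, (changeVector_sub_eq_jetMap M (hp u).contDiff_log (hp u₀).contDiff_log hF hh ?_
    hmix).symm⟩
  filter_upwards [h.open_source.mem_nhds hzh] with x hx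
  rw [h.left_inv hx]

end LatentCausal

theorem mainTheorem5 {n d : ℕ} (hnd : n ≤ d) {U : Type*}
    {T : Fin n → Type*} {E : Fin n → Type*} [∀ i, MeasurableSpace (E i)]
    (S : LatentCausal.LatentSEM n T E) (θ : U → ∀ i, T i)
    (g : (Fin n → ℝ) → (Fin d → ℝ)) (hg : LatentCausal.IsC2DiffeoOntoImage g)
    (p : U → (Fin n → ℝ) → ℝ)
    (hA1 : ∀ u, LatentCausal.HasSmoothPositiveDensity (S.law (θ u)) (p u))
    (hA2 : LatentCausal.SufficientChanges
      (LatentCausal.markovNetwork (fun u => S.law (θ u))) p)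
    (hSAF : LatentCausal.SingleAdjacencyFaithful S θ)
    (hSUCF : LatentCausal.SingleUnshieldedColliderFaithful S θ)
    (hG : ∃ i j, S.Edge i j)
    {T' : Fin n → Type*} {E' : Fin n → Type*} [∀ i, MeasurableSpace (E' i)]
    (S' : LatentCausal.LatentSEM n T' E') (θ' : U → ∀ i, T' i)
    (g' : (Fin n → ℝ) → (Fin d → ℝ)) (hg' : LatentCausal.IsC2DiffeoOntoImage g')
    (hind : ∀ u, iIndepFun (fun (i : Fin n) (z : Fin n → ℝ) => z i) (S'.law (θ' u))) :
    ¬ ∀ u, S.observedLaw g (θ u) = S'.observedLaw g' (θ' u) := by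
  intro hobs
  -- A2 at an arbitrary point serves here only to produce some domain.
  obtain ⟨u₀, -, -⟩ := hA2 0
  have hA := LatentCausal.ae_mem_range hg hg' (hA1 u₀) (hobs u₀)
  obtain ⟨z, h, hq⟩ := LatentCausal.exists_changeVector_sub_mem_range
    (LatentCausal.markovNetwork fun u => S.law (θ u)) hg hg' hA1 hA hobs hind
  obtain ⟨u₀, u, hu⟩ := hA2 z
  choose q hq using fun k => hq (u k) u₀
  -- Independence of the images forces independence of the `q k`, which live in a space of dimension
  -- `2n`.
  have hli : LinearIndependent ℝ q := by
    rw [← funext hq] at hu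
    exact LinearIndependent.of_comp
      (LatentCausal.jetMap (LatentCausal.markovNetwork fun u => S.law (θ u)) h z) hu
  have hcard := hli.fintype_card_le_finrank
  have hpos := LatentCausal.markovNetwork_edgeSet_ncard_pos hSAF hG
  simp only [Fintype.card_fin, Module.finrank_prod, Module.finrank_fintype_fun_eq_card] at hcard
  omega
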